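/- Let $k$ be a field of characteristic zero, let $n\ge 3$, and let $R=k[x_0,\ldots,x_n]$. Let $f\in R$ be the determinant of the $n\times n$ sub-Hankel matrix whose $(i,j)$ entry ($0\le i,j\le n-1$) is $x_{i+j}$ if $i+j\le n$ and $0$ if $i+j>n$. Let $J=\left(\frac{\partial f}{\partial x_0},\ldots,\frac{\partial f}{\partial x_n}\right)\subset R$ be the gradient ideal of $f$, and let $J_{n-2}\subset R$ be the ideal generated by the first $n-1$ partial derivatives $\frac{\partial f}{\partial x_0},\ldots,\frac{\partial f}{\partial x_{n-2}}$, each divided by the greatest common divisor of these $n-1$ polynomials. Set $P:=(x_{n-1},x_n)$. Then $\sqrt{J}=P$, and the $P$-primary component of $J$ is $J_{n-2}$; that is, $J_{n-2}$ is the member with radical $P$ of a minimal primary decomposition of $J$, and it is the only ideal of $R$ with this property. -/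

import Mathlib

namespace SubHankel

open MvPolynomial

noncomputable section

/-- The generic sub-Hankel matrix of order `n` on the variables `x_0, …, x_n`: its `(i, j)` entry
(rows and columns numbered from `0` to `n - 1`) is `x_{i+j}` if `i + j ≤ n`, and `0` otherwise. -/
def subHankelMatrix (k : Type*) [Field k] (n : ℕ) :
    Matrix (Fin n) (Fin n) (MvPolynomial (Fin (n + 1)) k) :=
  Matrix.of fun i j =>
    if h : i.val + j.val ≤ n then X ⟨i.val + j.val, Nat.lt_succ_of_le h⟩ else 0

/-- The sub-Hankel determinant `f`. -/
def subHankelDet (k : Type*) [Field k] (n : ℕ) : MvPolynomial (Fin (n + 1)) k :=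
  (subHankelMatrix k n).det

/-- The gradient ideal `J` of `f`, generated by all partial derivatives
`∂f/∂x_0, …, ∂f/∂x_n`. -/
def gradientIdeal (k : Type*) [Field k] (n : ℕ) : Ideal (MvPolynomial (Fin (n + 1)) k) :=
  Ideal.span (Set.range fun j : Fin (n + 1) => pderiv j (subHankelDet k n))

/-- The set of the first `i + 1` partial derivatives `∂f/∂x_0, …, ∂f/∂x_i`. -/
def firstPartials (k : Type*) [Field k] (n i : ℕ) : Set (MvPolynomial (Fin (n + 1)) k) :=
  {p | ∃ j : Fin (n + 1), j.val ≤ i ∧ p = pderiv j (subHankelDet k n)}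

/-- `d` is a greatest common divisor of the set `s`: the common divisors of `s` are exactly the
divisors of `d`. -/
def IsSetGCD {R : Type*} [CommRing R] (s : Set R) (d : R) : Prop :=
  ∀ e : R, e ∣ d ↔ ∀ a ∈ s, e ∣ a

/-- The ideal generated by the elements of `s` divided by their greatest common divisor. As this
is only determined up to a unit, the quotients by all nonzero greatest common divisors are taken;
in a domain this does not change the ideal generated. -/
def gcdQuotientIdeal {R : Type*} [CommRing R] (s : Set R) : Ideal R :=
  Ideal.span {q | ∃ d : R, d ≠ 0 ∧ IsSetGCD s d ∧ d * q ∈ s}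

/-- The ideal `J_i`, generated by the first `i + 1` partial derivatives of `f` divided by their
greatest common divisor. -/
def dividedIdeal (k : Type*) [Field k] (n i : ℕ) : Ideal (MvPolynomial (Fin (n + 1)) k) :=
  gcdQuotientIdeal (firstPartials k n i)

/-- `Q` is a `P`-primary component of `I`: it is the member with radical `P` of some minimal
(irredundant) primary decomposition of `I`. -/
def IsPrimaryComponent {R : Type*} [CommRing R] (I P Q : Ideal R) : Prop :=
  ∃ t : Finset (Ideal R), Submodule.IsMinimalPrimaryDecomposition I t ∧ Q ∈ t ∧ Q.radical = P

end

end SubHankel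

/-! Put `a_i = x_{n-i}` and `N = n - 2`, and let `F = 1 + a_1 t + a_2 a_0 t^2 + a_3 a_0^2 t^3 + ⋯`,
formally `a(a_0 t) / a_0` with `a(t) = ∑ a_i t^i`. Up to sign, `f` is the coefficient of `t^n` in
`1/F` (`exists_subHankelDet_eq`). Since `D(1/F) = -D(F)/F^2`, the partials of `f` are governed by
the coefficients `C_m` of `1/F^2`: up to one common unit, `∂f/∂x_m` is `a_0^{N+1-m} C_m` for `m ≤ N
+ 1`, and `∂f/∂x_n` is a linear combination of the elements `g_m = a_0^{N-m} C_m`, `m ≤ N`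
(`exists_pderiv_eq`). The first `n - 1` partials have gcd `a_0`, so `J_{n-2} = (g_0, …, g_N)`
(`dividedIdeal_eq`).

The differential equation of `1/F^2` gives linear recursions for the `C_m`, solvable in
characteristic zero. They have three uses. They put `C_{N+1}` in `J_{n-2}`, so `J ⊆ J_{n-2}`. They
make `J_{n-2}` primary: as polynomials in `a_1` the `g_m` have degree `m` and leading coefficient a
unit times a power of `a_0`, and `a_1 g_m` for `m < N` is a combination of the `g_l` with
coefficients free of `a_1`, so a triangular elimination applies (`isPrimary_homogenizedIdeal`).
Finally, together with the last two partials, they form a square linear system in the `g_m` with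
right-hand sides in `J`, triangular modulo `P` with unit multiples of `a_2` on the diagonal; by
Cramer's rule `J` and `J_{n-2}` agree locally at `P`
(`exists_notMem_forall_mul_homogenizedIdeal_mem`).

As `√J = P`, these facts identify the component (`isPrimaryComponent_iff_eq`). -/

namespace SubHankel

/-! ### Primary components at the radical -/

section PrimaryComponent

variable {R : Type*} [CommRing R]

lemma le_of_isPrimary_of_mul_mem {I P Q Q' : Ideal R} (hQ' : Q'.IsPrimary)
    (hP' : Q'.radical = P) (hle : I ≤ Q') {s : R} (hs : s ∉ P) (hsQ : ∀ q ∈ Q, s * q ∈ I) :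
    Q ≤ Q' := by
  intro q hq
  have h := hle (hsQ q hq)
  rw [mul_comm] at h
  exact ((Ideal.isPrimary_iff.mp hQ').2 h).resolve_right (hP' ▸ hs)

/-- If `√I = P` and `I` agrees with a `P`-primary ideal `Q₀` after inverting an element outside
of `P`, then `Q₀` is the only `P`-primary component of `I`. -/
theorem isPrimaryComponent_iff_eq [IsNoetherianRing R] {I P Q₀ : Ideal R} (hI : I.radical = P)
    (hQ₀ : Q₀.IsPrimary) (hP₀ : Q₀.radical = P) (hle : I ≤ Q₀) {s : R} (hs : s ∉ P)
    (hsQ : ∀ q ∈ Q₀, s * q ∈ I) (Q : Ideal R) : IsPrimaryComponent I P Q ↔ Q = Q₀ := by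
  classical
  have hPp : P.IsPrime := hP₀ ▸ Ideal.isPrime_radical hQ₀
  have key : ∀ Q, IsPrimaryComponent I P Q → Q = Q₀ := by
    rintro Q ⟨t, ht, hQt, hQP⟩
    have hIle : ∀ q ∈ t, I ≤ q := fun q hq => by
      rw [← ht.inf_eq]
      exact Finset.inf_le (f := id) hq
    -- Every member of `t` has radical containing `√I = P`, so a second member inside `P` would
    -- share its radical with `Q`, against minimality.
    have hnot : ¬ (t.erase Q).inf id ≤ P := by
      intro h
      obtain ⟨q, hq, hqP⟩ := (Ideal.IsPrime.inf_le' hPp).mp h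
      obtain ⟨hne, hqt⟩ := Finset.mem_erase.mp hq
      refine ht.distinct hqt hQt hne ?_
      have h1 : q.radical = P := le_antisymm ((Ideal.IsPrime.radical_le_iff hPp).mpr hqP)
        (hI ▸ Ideal.radical_mono (hIle q hqt))
      simpa using h1.trans hQP.symm
    obtain ⟨u, hu, huP⟩ := SetLike.not_le_iff_exists.mp hnot
    refine le_antisymm (le_of_isPrimary_of_mul_mem hQ₀ hP₀ hle huP fun q hq => ?_)
      (le_of_isPrimary_of_mul_mem (ht.primary hQt) hQP (hIle Q hQt) hs hsQ)
    rw [← ht.inf_eq, ← Finset.insert_erase hQt, Finset.inf_insert]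
    exact ⟨Ideal.mul_mem_left _ _ hq, Ideal.mul_mem_right _ _ hu⟩
  refine ⟨key Q, ?_⟩
  rintro rfl
  obtain ⟨t, ht⟩ := Submodule.IsLasker.exists_isMinimalPrimaryDecomposition
    (Submodule.isLasker R R) I
  have hmin : P ∈ I.minimalPrimes := by
    rw [← Ideal.radical_minimalPrimes, hI, Ideal.minimalPrimes_eq_subsingleton_self]
    rfl
  obtain ⟨q, hqt, hq⟩ :=
    Ideal.IsMinimalPrimaryDecomposition.minimalPrimes_subset_image_radical ht hmin
  have hc : IsPrimaryComponent I P q := ⟨t, ht, hqt, by simpa using hq⟩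
  exact key q hc ▸ hc

end PrimaryComponent

/-! ### Saturation of triangular families of polynomials -/

section TriangularFamily

open Polynomial

variable {A : Type*} [CommRing A] [IsDomain A]

lemma dvd_of_mul_eq_mul_unit_mul_pow {p s y c u : A} (hp : Prime p) (hs : ¬ p ∣ s) (hu : IsUnit u)
    {e : ℕ} (h : s * y = c * (u * p ^ e)) : s ∣ c := by
  have h1 : p ^ e ∣ y := (hp.pow_dvd_of_dvd_mul_left e hs) ⟨c * u, by rw [h]; ring⟩
  obtain ⟨z, rfl⟩ := h1
  have h2 : s * z = c * u := mul_right_cancel₀ (pow_ne_zero e hp.ne_zero)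
    (by linear_combination h)
  exact (hu.dvd_mul_right).mp ⟨z, h2.symm⟩

/-- A family of polynomials of strictly increasing degrees, with leading coefficients
unit multiples of powers of `p`, spans a submodule that is saturated with respect to elements not
divisible by `p`. -/
lemma exists_eq_sum_of_C_mul_eq_sum {p s : A} (hp : Prime p) (hs : ¬ p ∣ s) (h : ℕ → A[X])
    (hdeg : ∀ m, (h m).natDegree ≤ m)
    (hlead : ∀ m, ∃ u : A, ∃ e : ℕ, IsUnit u ∧ (h m).coeff m = u * p ^ e)
    (M : ℕ) (c : ℕ → A) (y : A[X]) (hy : C s * y = ∑ m ∈ Finset.range M, C (c m) * h m) :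
    ∃ d : ℕ → A, y = ∑ m ∈ Finset.range M, C (d m) * h m := by
  induction M generalizing y with
  | zero =>
    refine ⟨0, ?_⟩
    have hs0 : s ≠ 0 := fun h0 => hs (h0 ▸ dvd_zero p)
    simpa [hs0] using hy
  | succ M ih =>
    obtain ⟨u, e, hu, hue⟩ := hlead M
    -- Only `h M` reaches degree `M`, so comparing coefficients there shows `s ∣ c M`, and the top
    -- term can be subtracted.
    have h0 : s * y.coeff M = c M * (u * p ^ e) := by
      rw [← coeff_C_mul, hy, Finset.sum_range_succ, coeff_add, coeff_C_mul, hue, finsetSum_coeff,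
        Finset.sum_eq_zero, zero_add]
      intro i hi
      rw [coeff_C_mul, coeff_eq_zero_of_natDegree_lt, mul_zero]
      exact (hdeg i).trans_lt (Finset.mem_range.mp hi)
    obtain ⟨z, hz⟩ := dvd_of_mul_eq_mul_unit_mul_pow hp hs hu h0
    obtain ⟨d, hd⟩ := ih (y - C z * h M) (by
      rw [mul_sub, hy, Finset.sum_range_succ, hz, C_mul]
      ring)
    refine ⟨Function.update d M z, ?_⟩
    rw [Finset.sum_range_succ, Function.update_self, ← sub_eq_iff_eq_add, hd]
    refine Finset.sum_congr rfl fun i hi => ?_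
    rw [Function.update_of_ne (Finset.mem_range.mp hi).ne]

/-- An ideal of `A[X]` generated by polynomials `g 0, …, g N` with `deg (g m) ≤ m`, with `m`-th
coefficients unit multiples of powers of a prime `p` (a unit for `m = N`), and with linear syzygies
expressing `X * g m` through `g 0, …, g N`, is saturated with respect to
elements of `A` not divisible by `p`. -/
theorem mem_span_of_C_mul_mem_span {p s : A} (hp : Prime p) (hs : ¬ p ∣ s) (N : ℕ) (g : ℕ → A[X])
    (hdeg : ∀ m ≤ N, (g m).natDegree ≤ m)
    (hlead : ∀ m ≤ N, ∃ u : A, ∃ e : ℕ, IsUnit u ∧ (g m).coeff m = u * p ^ e)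
    (hrel : ∀ m < N, X * g m ∈ Submodule.span A (g '' Set.Iic N)) {y : A[X]}
    (hy : C s * y ∈ Ideal.span (g '' Set.Iic N)) : y ∈ Ideal.span (g '' Set.Iic N) := by
  -- Continuing the family by `X ^ j * g N` keeps it triangular, and `hrel` makes its `A`-span
  -- closed under `X`, hence equal to the ideal.
  set h : ℕ → A[X] := fun m => X ^ (m - N) * g (min m N) with h_def
  have hh : ∀ m ≤ N, h m = g m := fun m hm => by simp [h_def, hm]
  have hdeg' : ∀ m, (h m).natDegree ≤ m := fun m => by
    refine natDegree_mul_le.trans ?_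
    have := hdeg (min m N) (min_le_right _ _)
    rw [natDegree_X_pow]
    omega
  have hlead' : ∀ m, ∃ u : A, ∃ e : ℕ, IsUnit u ∧ (h m).coeff m = u * p ^ e := fun m => by
    obtain ⟨u, e, hu, hue⟩ := hlead (min m N) (min_le_right _ _)
    refine ⟨u, e, hu, ?_⟩
    rw [← hue, h_def]
    conv_lhs => rw [show m = min m N + (m - N) by omega]
    simp only [show min m N + (m - N) = m by omega]
    rw [coeff_X_pow_mul']
    rw [if_pos (by omega)]
    congr 1
    omega
  have hsub : Submodule.span A (g '' Set.Iic N) ≤ Submodule.span A (Set.range h) := by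
    refine Submodule.span_mono ?_
    rintro _ ⟨m, hm, rfl⟩
    exact ⟨m, hh m hm⟩
  have hX : ∀ z ∈ Submodule.span A (Set.range h), X * z ∈ Submodule.span A (Set.range h) := by
    intro z hz
    induction hz using Submodule.span_induction with
    | mem z hz =>
      obtain ⟨m, rfl⟩ := hz
      rcases lt_or_ge m N with hm | hm
      · rw [hh m hm.le]
        exact hsub (hrel m hm)
      · refine Submodule.subset_span ⟨m + 1, ?_⟩
        simp only [h_def, min_eq_right hm, min_eq_right (hm.trans m.le_succ),
          show m + 1 - N = m - N + 1 by omega, pow_succ]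
        ring
    | zero => simp
    | add x y _ _ hx hy => rw [mul_add]; exact add_mem hx hy
    | smul c x _ hx => rw [mul_smul_comm]; exact Submodule.smul_mem _ _ hx
  have hmul : ∀ q z, z ∈ Submodule.span A (Set.range h) →
      q * z ∈ Submodule.span A (Set.range h) := by
    intro q
    induction q using Polynomial.induction_on' with
    | add p q hp hq => intro z hz; rw [add_mul]; exact add_mem (hp z hz) (hq z hz)
    | monomial n a =>
      intro z hz
      rw [← C_mul_X_pow_eq_monomial, mul_assoc, ← smul_eq_C_mul]
      refine Submodule.smul_mem _ _ ?_
      induction n with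
      | zero => simpa using hz
      | succ n ih => rw [pow_succ', mul_assoc]; exact hX _ ih
  have hmem : C s * y ∈ Submodule.span A (Set.range h) := by
    generalize C s * y = z at hy
    induction hy using Submodule.span_induction with
    | mem z hz => exact hsub (Submodule.subset_span hz)
    | zero => exact zero_mem _
    | add x y _ _ hx hy => exact add_mem hx hy
    | smul c x _ hx => exact hmul c x hx
  obtain ⟨l, hl⟩ := (Finsupp.mem_span_range_iff_exists_finsupp).mp hmem
  obtain ⟨M, hM⟩ := l.support.exists_nat_subset_range
  obtain ⟨d, hd⟩ := exists_eq_sum_of_C_mul_eq_sum hp hs h hdeg' hlead' M l y (by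
    rw [← hl, Finsupp.sum_of_support_subset _ hM _ (by simp)]
    simp [smul_eq_C_mul])
  rw [hd]
  refine Ideal.sum_mem _ fun m _ => Ideal.mul_mem_left _ _ (Ideal.mul_mem_left _ _ ?_)
  exact Ideal.subset_span ⟨min m N, Set.mem_Iic.mpr (min_le_right _ _), rfl⟩

end TriangularFamily

end SubHankel

namespace SubHankel

/-! ### The reciprocal series, its square and their derivatives -/

section Series

open PowerSeries

variable {R : Type*} [CommRing R] (a : ℕ → R)

/-- The power series `∑ a_i t^i`, rescaled to have constant coefficient `1`. -/
noncomputable def normalizedSeries : PowerSeries R :=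
  PowerSeries.mk fun i => if i = 0 then 1 else a i * a 0 ^ (i - 1)

/-- The reciprocal of the normalized series. -/
noncomputable def reciprocalSeries : PowerSeries R := invOfUnit (normalizedSeries a) 1

/-- The coefficients of the reciprocal series. -/
noncomputable def recipCoeff (m : ℕ) : R := coeff m (reciprocalSeries a)

/-- The coefficients of the square of the reciprocal series. -/
noncomputable def recipSqCoeff (m : ℕ) : R := coeff m (reciprocalSeries a ^ 2)

lemma coeff_normalizedSeries_zero : coeff 0 (normalizedSeries a) = 1 := by
  simp [normalizedSeries]

lemma coeff_normalizedSeries_succ (i : ℕ) :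
    coeff (i + 1) (normalizedSeries a) = a (i + 1) * a 0 ^ i := by
  simp [normalizedSeries]

lemma normalizedSeries_mul_reciprocalSeries :
    normalizedSeries a * reciprocalSeries a = 1 := by
  refine mul_invOfUnit _ _ ?_
  rw [← coeff_zero_eq_constantCoeff_apply, coeff_normalizedSeries_zero, Units.val_one]

lemma constantCoeff_reciprocalSeries : constantCoeff (reciprocalSeries a) = 1 := by
  simp [reciprocalSeries]

lemma recipSqCoeff_zero : recipSqCoeff a 0 = 1 := by
  simp [recipSqCoeff, constantCoeff_reciprocalSeries]

lemma sum_range_mul_recipCoeff (m : ℕ) :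
    ∑ i ∈ Finset.range (m + 1), a i * a 0 ^ i * recipCoeff a (m - i) = if m = 0 then a 0 else 0 := by
  -- The factor `a 0` gives the constant coefficient `1` the same shape `a i * a 0 ^ i` as the
  -- others.
  have h := congrArg (fun φ => a 0 * coeff m φ) (normalizedSeries_mul_reciprocalSeries a)
  simp only [coeff_mul, coeff_one] at h
  rw [Finset.Nat.sum_antidiagonal_eq_sum_range_succ
    (fun i j => coeff i (normalizedSeries a) * coeff j (reciprocalSeries a)), Finset.mul_sum] at h
  rw [show (if m = 0 then a 0 else 0) = a 0 * if m = 0 then 1 else 0 by split_ifs <;> simp, ← h]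
  refine Finset.sum_congr rfl fun i _ => ?_
  cases i with
  | zero => simp [coeff_normalizedSeries_zero, recipCoeff]
  | succ i => rw [coeff_normalizedSeries_succ, recipCoeff, pow_succ]; ring

lemma coeff_X_mul_derivative (φ : PowerSeries R) (m : ℕ) :
    coeff m (X * d⁄dX R φ) = m * coeff m φ := by
  cases m with
  | zero => simp
  | succ m => rw [coeff_succ_X_mul, coeff_derivative]; push_cast; ring

/-- With `H = 1/F^2`, this is the coefficient of `t^m` in `F · tH' + 2 tF' · H = 0`; the weight is
`(m - i) + 2i = m + i`. -/
lemma sum_range_mul_recipSqCoeff (m : ℕ) :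
    ∑ i ∈ Finset.range (m + 1),
      ((m : R) + i) * coeff i (normalizedSeries a) * recipSqCoeff a (m - i) = 0 := by
  have h1 := normalizedSeries_mul_reciprocalSeries a
  have h2 := congrArg (d⁄dX R) h1
  rw [Derivation.leibniz, Derivation.map_one_eq_zero] at h2
  simp only [smul_eq_mul] at h2
  have h3 : normalizedSeries a * (X * d⁄dX R (reciprocalSeries a ^ 2))
      + 2 * (X * d⁄dX R (normalizedSeries a)) * reciprocalSeries a ^ 2 = 0 := by
    rw [pow_two, Derivation.leibniz, smul_eq_mul]
    linear_combination (2 * X * reciprocalSeries a) * h2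
  have h4 := congrArg (coeff m) h3
  rw [two_mul, add_mul, map_add, map_add, map_zero, coeff_mul, coeff_mul,
    ← Finset.sum_add_distrib, ← Finset.sum_add_distrib] at h4
  rw [← h4, ← Finset.Nat.sum_antidiagonal_eq_sum_range_succ
    (fun i j => ((m : R) + i) * coeff i (normalizedSeries a) * recipSqCoeff a j)]
  refine Finset.sum_congr rfl fun ij hij => ?_
  rw [coeff_X_mul_derivative, coeff_X_mul_derivative, recipSqCoeff,
    ← Finset.HasAntidiagonal.mem_antidiagonal.mp hij]
  push_cast
  ring

lemma recipSqCoeff_succ (m : ℕ) :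
    ((m : R) + 1) * recipSqCoeff a (m + 1) = - ∑ i ∈ Finset.range (m + 1),
      ((m : R) + i + 2) * (a (i + 1) * a 0 ^ i) * recipSqCoeff a (m - i) := by
  have h := sum_range_mul_recipSqCoeff a (m + 1)
  rw [Finset.sum_range_succ', coeff_normalizedSeries_zero] at h
  rw [eq_neg_iff_add_eq_zero, ← h, add_comm]
  congr 1
  · refine Finset.sum_congr rfl fun i _ => ?_
    rw [coeff_normalizedSeries_succ, Nat.add_sub_add_right]
    push_cast
    ring
  · push_cast
    simp

/-- Applied coefficientwise, `D` is a derivation of the power series ring, so `D(1/F) = -D(F)/F^2`.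
-/
lemma derivation_recipCoeff {k : Type*} [CommRing k] [Algebra k R] (D : Derivation k R R) (m : ℕ) :
    D (recipCoeff a m) = - ∑ i ∈ Finset.range (m + 1),
      D (coeff i (normalizedSeries a)) * recipSqCoeff a (m - i) := by
  let E : PowerSeries R → PowerSeries R := fun φ => PowerSeries.mk fun i => D (coeff i φ)
  have hE : ∀ φ ψ, E (φ * ψ) = φ * E ψ + ψ * E φ := by
    intro φ ψ
    rw [mul_comm ψ]
    ext i
    simp only [E, coeff_mk, coeff_mul, map_add, map_sum, Derivation.leibniz, smul_eq_mul,
      ← Finset.sum_add_distrib]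
    refine Finset.sum_congr rfl fun ij _ => ?_
    ring
  have h1 := normalizedSeries_mul_reciprocalSeries a
  have h2 := congrArg E h1
  have h3 : E 1 = 0 := by
    ext i
    simp only [E, coeff_mk, coeff_one, map_zero]
    split_ifs <;> simp
  rw [hE, h3] at h2
  have h4 : E (reciprocalSeries a) = - (E (normalizedSeries a) * reciprocalSeries a ^ 2) := by
    linear_combination (reciprocalSeries a) * h2 - (E (reciprocalSeries a)) * h1
  have h5 := congrArg (coeff m) h4
  rw [map_neg, coeff_mul, Finset.Nat.sum_antidiagonal_eq_sum_range_succ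
    (fun i j => coeff i (E (normalizedSeries a)) * coeff j (reciprocalSeries a ^ 2))] at h5
  simp only [E, coeff_mk] at h5
  exact h5

lemma derivation_recipCoeff_of_pos {k : Type*} [CommRing k] [Algebra k R] (D : Derivation k R R)
    {j m : ℕ} (hj : 0 < j) (hjm : j ≤ m) (hD : ∀ i, D (a i) = if i = j then 1 else 0) :
    D (recipCoeff a m) = - (a 0 ^ (j - 1) * recipSqCoeff a (m - j)) := by
  have h0 : D (a 0) = 0 := by rw [hD, if_neg hj.ne]
  rw [derivation_recipCoeff, Finset.sum_eq_single j]
  · obtain ⟨j, rfl⟩ := Nat.exists_eq_succ_of_ne_zero hj.ne'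
    rw [Nat.succ_eq_add_one, coeff_normalizedSeries_succ, Derivation.leibniz,
      Derivation.leibniz_pow, h0, hD]
    simp
  · intro i _ hij
    cases i with
    | zero => simp [coeff_normalizedSeries_zero]
    | succ i =>
      rw [coeff_normalizedSeries_succ, Derivation.leibniz, Derivation.leibniz_pow, h0, hD,
        if_neg hij]
      simp
  · intro h
    exact absurd (Finset.mem_range.mpr (by omega)) h

lemma derivation_recipCoeff_zero {k : Type*} [CommRing k] [Algebra k R] (D : Derivation k R R)
    (m : ℕ) (hD : ∀ i, D (a i) = if i = 0 then 1 else 0) :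
    D (recipCoeff a (m + 2)) = - ∑ i ∈ Finset.range (m + 1),
      ((i : R) + 1) * a (i + 2) * (a 0 ^ i * recipSqCoeff a (m - i)) := by
  rw [derivation_recipCoeff, Finset.sum_range_succ', Finset.sum_range_succ',
    coeff_normalizedSeries_zero, coeff_normalizedSeries_succ]
  have h1 : D (a (0 + 1) * a 0 ^ 0) = 0 := by simp [hD]
  rw [h1, Derivation.map_one_eq_zero, zero_mul, add_zero, zero_mul, add_zero]
  congr 1
  refine Finset.sum_congr rfl fun i _ => ?_
  rw [coeff_normalizedSeries_succ, Derivation.leibniz, Derivation.leibniz_pow, hD, hD,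
    Nat.add_sub_add_right]
  simp
  ring

end Series

/-! ### Toeplitz determinants -/

section Determinant

variable {R : Type*} [CommRing R]

/-- The lower triangular Toeplitz matrix of a sequence. -/
noncomputable def lowerToeplitz (a : ℕ → R) (n : ℕ) : Matrix (Fin n) (Fin n) R :=
  Matrix.of fun i j => if j.val ≤ i.val then a (i.val - j.val) else 0

lemma det_lowerToeplitz (a : ℕ → R) (n : ℕ) : (lowerToeplitz a n).det = a 0 ^ n := by
  rw [Matrix.det_of_isLowerTriangular]
  · simp [lowerToeplitz]
  · intro i j hij
    exact if_neg (not_le.mpr hij)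

/-- Row `i` is `a 0 ^ (n - i)` times the coefficient of `t^i` in `a_0 · F · (1/F)`; the powers of `a
0` in the vector clear the denominators of the substitution `t ↦ t / a_0`. -/
lemma lowerToeplitz_mulVec (a : ℕ → R) (n : ℕ) :
    (lowerToeplitz a (n + 1)).mulVec (fun j => a 0 ^ (n - j.val) * recipCoeff a j.val) =
      a 0 ^ (n + 1) • Pi.single 0 1 := by
  ext i
  have h : ∀ j ∈ Finset.range (n + 1), (if j ≤ i.val then a (i.val - j) else 0) *
      (a 0 ^ (n - j) * recipCoeff a j) = if j ∈ Finset.range (i.val + 1) then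
        a 0 ^ (n - i.val) * (a (i.val - j) * a 0 ^ (i.val - j) * recipCoeff a j) else 0 := by
    intro j _
    by_cases hj : j ≤ i.val
    · rw [if_pos hj, if_pos (Finset.mem_range.mpr (by omega)),
        show n - j = (n - i.val) + (i.val - j) by omega, pow_add]
      ring
    · rw [if_neg hj, if_neg (by simpa using hj), zero_mul]
  simp only [Matrix.mulVec, dotProduct, lowerToeplitz, Matrix.of_apply]
  rw [Fin.sum_univ_eq_sum_range (fun j => (if j ≤ i.val then a (i.val - j) else 0) *
      (a 0 ^ (n - j) * recipCoeff a j)) (n + 1), Finset.sum_congr rfl h, ← Finset.sum_filter,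
    Finset.filter_mem_eq_inter, Finset.inter_eq_right.mpr (Finset.range_mono (by omega)),
    ← Finset.mul_sum]
  have h2 : ∑ j ∈ Finset.range (i.val + 1), a (i.val - j) * a 0 ^ (i.val - j) * recipCoeff a j
      = if i.val = 0 then a 0 else 0 := by
    rw [← sum_range_mul_recipCoeff, ← Finset.sum_range_reflect]
    refine Finset.sum_congr rfl fun j hj => ?_
    have := Finset.mem_range.mp hj
    rw [show i.val + 1 - 1 - j = i.val - j by omega, show i.val - (i.val - j) = j by omega]
  rw [h2, Pi.smul_apply, Pi.single_apply, smul_eq_mul]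
  by_cases hi : i = 0
  · simp [hi, pow_succ]
  · rw [if_neg (fun h => hi (Fin.ext (by simpa using h))), if_neg hi]
    simp

/-- The Toeplitz determinant formula for the coefficients of a reciprocal power series. -/
lemma det_toeplitz_eq [IsDomain R] (a : ℕ → R) (ha : a 0 ≠ 0) (n : ℕ) :
    (Matrix.of fun i j : Fin n => if j.val ≤ i.val + 1 then a (i.val + 1 - j.val) else 0).det =
      (-1) ^ n * recipCoeff a n := by
  have h := congrArg (lowerToeplitz a (n + 1)).adjugate.mulVec (lowerToeplitz_mulVec a n)
  rw [Matrix.mulVec_mulVec, Matrix.adjugate_mul, det_lowerToeplitz, Matrix.smul_mulVec,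
    Matrix.one_mulVec, Matrix.mulVec_smul, Matrix.mulVec_single_one] at h
  have h2 := congrFun h (Fin.last n)
  simp only [Pi.smul_apply, smul_eq_mul, Fin.val_last, Nat.sub_self, pow_zero, one_mul] at h2
  have h3 := mul_left_cancel₀ (pow_ne_zero _ ha) h2
  -- This adjugate entry is the signed minor without row `0` and the last column, which is the
  -- Toeplitz matrix shifted by one.
  rw [Matrix.col_apply, Matrix.adjugate_fin_succ_eq_det_submatrix] at h3
  rw [h3, ← mul_assoc, ← pow_add]
  simp only [Fin.val_zero, Fin.val_last, zero_add]
  rw [Even.neg_one_pow ⟨n, rfl⟩, one_mul]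
  congr 1
  ext i j
  have hij : j.castSucc ≤ i.succ ↔ j.val ≤ i.val + 1 := Iff.rfl
  simp [lowerToeplitz, hij]

end Determinant

/-! ### The sub-Hankel determinant as a reciprocal coefficient -/

section Hankel

open MvPolynomial

variable (k : Type*) [Field k] (n : ℕ)

/-- The variables in reversed order: `a_i = x_{n-i}` for `i ≤ n`, and `a_i = 0` for `i > n`. -/
noncomputable def revVar (i : ℕ) : MvPolynomial (Fin (n + 1)) k :=
  if i ≤ n then X ⟨n - i, by omega⟩ else 0

lemma revVar_of_le {i : ℕ} (hi : i ≤ n) : revVar k n i = X ⟨n - i, by omega⟩ := if_pos hi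

lemma pderiv_revVar {j : ℕ} (hj : j ≤ n) (i : ℕ) :
    pderiv (⟨n - j, by omega⟩ : Fin (n + 1)) (revVar k n i) = if i = j then 1 else 0 := by
  classical
  by_cases hi : i ≤ n
  · rw [revVar_of_le k n hi, pderiv_X, Pi.single_apply]
    refine if_congr ?_ rfl rfl
    rw [Fin.mk.injEq]
    omega
  · rw [revVar, if_neg hi, map_zero, if_neg (by omega)]

lemma exists_subHankelDet_eq :
    ∃ e : k, e ≠ 0 ∧ subHankelDet k n = C e * recipCoeff (revVar k n) n := by
  have h0 : revVar k n 0 ≠ 0 := by rw [revVar_of_le k n n.zero_le]; exact X_ne_zero _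
  have h1 := det_toeplitz_eq (revVar k n) h0 n
  -- Reversing the rows turns the Hankel pattern into a Toeplitz one, at the cost of a sign.
  have h2 : subHankelMatrix k n = (Matrix.of fun i j : Fin n => if j.val ≤ i.val + 1 then
      revVar k n (i.val + 1 - j.val) else 0).submatrix Fin.revPerm id := by
    ext1 i j
    simp only [subHankelMatrix, Matrix.of_apply, Matrix.submatrix_apply, Fin.revPerm_apply,
      Fin.val_rev, id]
    by_cases h : i.val + j.val ≤ n
    · rw [dif_pos h, if_pos (by omega), revVar_of_le k n (by omega)]
      congr 2
      omega
    · rw [dif_neg h, if_neg (by omega)]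
  refine ⟨((Equiv.Perm.sign (Fin.revPerm : Equiv.Perm (Fin n)) : ℤ) : k) * (-1) ^ n, ?_, ?_⟩
  · refine mul_ne_zero ?_ (pow_ne_zero _ (neg_ne_zero.mpr one_ne_zero))
    rcases Int.units_eq_one_or (Equiv.Perm.sign (Fin.revPerm : Equiv.Perm (Fin n))) with h | h <;>
      rw [h] <;> simp
  · rw [subHankelDet, h2, Matrix.det_permute, h1, ← mul_assoc]
    simp

end Hankel

end SubHankel

namespace SubHankel

/-! ### Generators of the divided ideal and their linear relations -/

section Generators

variable {R : Type*} [CommRing R] (a : ℕ → R)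

/-- The elements `a_0^{N-m} C_m`, where `C_m` is the `m`-th coefficient of the square of the
reciprocal series. -/
noncomputable def homogenizedCoeff (N m : ℕ) : R := a 0 ^ (N - m) * recipSqCoeff a m

lemma homogenizedCoeff_self (N : ℕ) : homogenizedCoeff a N N = recipSqCoeff a N := by
  simp [homogenizedCoeff]

lemma homogenizedCoeff_zero (N : ℕ) : homogenizedCoeff a N 0 = a 0 ^ N := by
  simp [homogenizedCoeff, recipSqCoeff_zero]

lemma pow_mul_recipSqCoeff {N M i : ℕ} (hM : M ≤ N) (hi : i ≤ M) :
    a 0 ^ (N - M) * a 0 ^ i * recipSqCoeff a (M - i) = homogenizedCoeff a N (M - i) := by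
  rw [homogenizedCoeff, ← pow_add]
  congr 2
  omega

lemma sum_range_mul_homogenizedCoeff {N M : ℕ} (hM : M ≤ N) :
    ∑ i ∈ Finset.range (M + 1), ((M : R) + i) * a i * homogenizedCoeff a N (M - i) = 0 := by
  have h := congrArg (fun x => a 0 ^ (N - M) * (a 0 * x)) (sum_range_mul_recipSqCoeff a M)
  simp only [mul_zero, Finset.mul_sum] at h
  rw [← h]
  refine Finset.sum_congr rfl fun i hi => ?_
  rw [← pow_mul_recipSqCoeff a hM (by have := Finset.mem_range.mp hi; omega)]
  cases i with
  | zero => rw [coeff_normalizedSeries_zero]; ring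
  | succ i => rw [coeff_normalizedSeries_succ]; ring

lemma sum_range_reflect_sub {M : ℕ} (F : ℕ → ℕ → R) :
    ∑ i ∈ Finset.range (M + 1), F i (M - i) = ∑ l ∈ Finset.range (M + 1), F (M - l) l := by
  rw [← Finset.sum_range_reflect]
  refine Finset.sum_congr rfl fun i hi => ?_
  have := Finset.mem_range.mp hi
  rw [show M + 1 - 1 - i = M - i by omega, show M - (M - i) = i by omega]

lemma mul_recipSqCoeff_succ_eq (N : ℕ) :
    ((N : R) + 1) * recipSqCoeff a (N + 1) = - ∑ i ∈ Finset.range (N + 1),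
      ((N : R) + i + 2) * a (i + 1) * homogenizedCoeff a N (N - i) := by
  rw [recipSqCoeff_succ]
  congr 1
  refine Finset.sum_congr rfl fun i hi => ?_
  rw [← pow_mul_recipSqCoeff a le_rfl (by have := Finset.mem_range.mp hi; omega), Nat.sub_self]
  ring

/-- The ideal generated by the elements `a_0^{N-m} C_m`, `m ≤ N`. -/
noncomputable def homogenizedIdeal (N : ℕ) : Ideal R :=
  Ideal.span (homogenizedCoeff a N '' Set.Iic N)

lemma homogenizedCoeff_mem {N m : ℕ} (hm : m ≤ N) :
    homogenizedCoeff a N m ∈ homogenizedIdeal a N :=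
  Ideal.subset_span ⟨m, hm, rfl⟩

lemma zero_mem_radical_homogenizedIdeal (N : ℕ) : a 0 ∈ (homogenizedIdeal a N).radical :=
  ⟨N, homogenizedCoeff_zero a N ▸ homogenizedCoeff_mem a N.zero_le⟩

variable (hu : ∀ m : ℕ, IsUnit ((m : R) + 1))
include hu

lemma recipSqCoeff_succ_mem (N : ℕ) : recipSqCoeff a (N + 1) ∈ homogenizedIdeal a N := by
  rw [← Ideal.unit_mul_mem_iff_mem _ (hu N), mul_recipSqCoeff_succ_eq]
  exact neg_mem (Ideal.sum_mem _ fun i _ => Ideal.mul_mem_left _ _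
    (homogenizedCoeff_mem a (Nat.sub_le _ _)))

/-- Modulo `a_0` the series `F` is `1 + a_1 t`, whose inverse square has these coefficients. -/
lemma dvd_recipSqCoeff_sub (m : ℕ) :
    a 0 ∣ recipSqCoeff a m - (-1) ^ m * ((m : R) + 1) * a 1 ^ m := by
  induction m with
  | zero => simp [recipSqCoeff_zero]
  | succ m ih =>
    rw [← (hu m).dvd_mul_left, mul_sub, recipSqCoeff_succ, Finset.sum_range_succ']
    have h1 : a 0 ∣ ∑ i ∈ Finset.range m, ((m : R) + (i + 1 : ℕ) + 2) *
        (a (i + 1 + 1) * a 0 ^ (i + 1)) * recipSqCoeff a (m - (i + 1)) :=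
      Finset.dvd_sum fun i _ => ⟨((m : R) + (i + 1 : ℕ) + 2) * a (i + 1 + 1) * a 0 ^ i *
        recipSqCoeff a (m - (i + 1)), by ring⟩
    obtain ⟨y, hy⟩ := h1
    obtain ⟨z, hz⟩ := ih
    refine ⟨- y - (m + 2) * a 1 * z, ?_⟩
    rw [hy]
    push_cast
    rw [pow_zero, Nat.sub_zero]
    linear_combination (-(m + 2) * a 1) * hz

lemma isUnit_neg_one_pow_mul (m : ℕ) : IsUnit ((-1) ^ m * ((m : R) + 1)) :=
  (isUnit_one.neg.pow m).mul (hu m)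

lemma mem_radical_of_recipSqCoeff_mem {I : Ideal R} {m : ℕ} (h0 : a 0 ∈ I.radical)
    (hm : recipSqCoeff a m ∈ I) : a 1 ∈ I.radical := by
  obtain ⟨z, hz⟩ := dvd_recipSqCoeff_sub a hu m
  refine I.radical_isRadical ⟨m, ?_⟩
  rw [← Ideal.unit_mul_mem_iff_mem _ (isUnit_neg_one_pow_mul hu m)]
  rw [show (-1) ^ m * ((m : R) + 1) * a 1 ^ m = recipSqCoeff a m - a 0 * z by
    rw [← hz, sub_sub_cancel]]
  exact sub_mem (Ideal.le_radical hm) (Ideal.mul_mem_right _ _ h0)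

lemma one_mem_radical_homogenizedIdeal (N : ℕ) : a 1 ∈ (homogenizedIdeal a N).radical :=
  mem_radical_of_recipSqCoeff_mem a hu (zero_mem_radical_homogenizedIdeal a N)
    (homogenizedCoeff_self a N ▸ homogenizedCoeff_mem a le_rfl)

lemma homogenizedIdeal_le {P : Ideal R} (h0 : a 0 ∈ P) (h1 : a 1 ∈ P) {N : ℕ} (hN : N ≠ 0) :
    homogenizedIdeal a N ≤ P := by
  refine Ideal.span_le.mpr ?_
  rintro _ ⟨m, hm, rfl⟩
  rcases (Set.mem_Iic.mp hm).lt_or_eq with hlt | rfl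
  · exact Ideal.mul_mem_right _ _ (Ideal.pow_mem_of_mem _ h0 _ (by omega))
  · obtain ⟨z, hz⟩ := dvd_recipSqCoeff_sub a hu m
    rw [homogenizedCoeff_self, sub_eq_iff_eq_add.mp hz]
    exact add_mem (Ideal.mul_mem_right _ _ h0)
      (Ideal.mul_mem_left _ _ (Ideal.pow_mem_of_mem _ h1 _ (by omega)))

omit hu in
/-- Cramer's rule for a system that is triangular modulo a prime ideal. -/
lemma exists_notMem_forall_mul_mem {P J : Ideal R} [P.IsPrime] (M : ℕ) (g : ℕ → R) (c : ℕ → ℕ → R)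
    (hc : ∀ m < M, ∑ l ∈ Finset.range M, c m l * g l ∈ J) (hup : ∀ m < M, ∀ l, m < l → c m l ∈ P)
    (hdiag : ∀ m < M, c m m ∉ P) : ∃ s ∉ P, ∀ m < M, s * g m ∈ J := by
  let B : Matrix (Fin M) (Fin M) R := Matrix.of fun i j => c i j
  refine ⟨B.det, ?_, fun m hm => ?_⟩
  · rw [← Ideal.Quotient.eq_zero_iff_mem, RingHom.map_det, Matrix.det_of_isLowerTriangular]
    · refine Finset.prod_ne_zero_iff.mpr fun i _ => ?_
      exact fun h => hdiag i i.2 (Ideal.Quotient.eq_zero_iff_mem.mp h)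
    · intro i j hij
      exact Ideal.Quotient.eq_zero_iff_mem.mpr (hup i i.2 j hij)
  · have h := congrFun (congrArg (fun D => D.mulVec fun i : Fin M => g i)
      (Matrix.adjugate_mul B)) ⟨m, hm⟩
    simp only [← Matrix.mulVec_mulVec, Matrix.smul_mulVec, Matrix.one_mulVec, Pi.smul_apply,
      smul_eq_mul] at h
    rw [← h, Matrix.mulVec, dotProduct]
    refine Ideal.sum_mem _ fun i _ => Ideal.mul_mem_left _ _ ?_
    have := hc i i.2
    rwa [← Fin.sum_univ_eq_sum_range (fun l => c i l * g l)] at this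

/-- If `J` contains the next coefficient `C_{N+1}` and a further combination of the generators,
it agrees with the ideal of the `a_0^{N-m} C_m` locally at a prime
containing `a_0` and `a_1` but not `a_2`. -/
lemma exists_notMem_forall_mul_homogenizedIdeal_mem {P J : Ideal R} [P.IsPrime] (h0 : a 0 ∈ P)
    (h1 : a 1 ∈ P) (h2 : a 2 ∉ P) {N : ℕ} (hJ1 : recipSqCoeff a (N + 1) ∈ J)
    (hJ2 : ∑ i ∈ Finset.range (N + 1),
      ((i : R) + 1) * a (i + 2) * homogenizedCoeff a N (N - i) ∈ J) :
    ∃ s ∉ P, ∀ q ∈ homogenizedIdeal a N, s * q ∈ J := by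
  have hnat : ∀ m : ℕ, ((m : R) + 1) * a 2 ∉ P := fun m =>
    fun h => h2 ((Ideal.unit_mul_mem_iff_mem _ (hu m)).mp h)
  -- Row `m` is the recursion of order `m + 2` if `m + 2 ≤ N`, the formula for `C_{N+1}` if `m + 1 =
  -- N`, and `hJ2` if `m = N`. With this shift the diagonal carries unit multiples of `a 2`, and
  -- only `a 0` and `a 1` occur to its right.
  let c : ℕ → ℕ → R := fun m l =>
    if m + 2 ≤ N then (if l ≤ m + 2 then (((m + 2 : ℕ) : R) + (m + 2 - l : ℕ)) * a (m + 2 - l) else 0)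
    else if m + 1 = N then ((N : R) + (N - l : ℕ) + 2) * a (N - l + 1) * (if l ≤ N then 1 else 0)
    else (((N - l : ℕ) : R) + 1) * a (N - l + 2) * (if l ≤ N then 1 else 0)
  have key : ∃ s ∉ P, ∀ m < N + 1, s * homogenizedCoeff a N m ∈ J := by
    refine exists_notMem_forall_mul_mem (N + 1) _ c (fun m hm => ?_) (fun m hm l hl => ?_)
      (fun m hm => ?_)
    · rcases lt_trichotomy (m + 1) N with hlt | heq | hgt
      · have h := sum_range_mul_homogenizedCoeff a (show m + 2 ≤ N by omega)
        rw [sum_range_reflect_sub (fun i j => (((m + 2 : ℕ) : R) + i) * a i *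
          homogenizedCoeff a N j)] at h
        convert J.zero_mem
        rw [← h]
        symm
        refine Finset.sum_subset_zero_on_sdiff (Finset.range_mono (by omega)) ?_ ?_
        · intro l hl
          simp only [Finset.mem_sdiff, Finset.mem_range] at hl
          simp only [c]
          rw [if_pos (by omega), if_neg (by omega), zero_mul]
        · intro l hl
          have := Finset.mem_range.mp hl
          simp only [c]
          rw [if_pos (by omega), if_pos (by omega)]
      · have h := mul_recipSqCoeff_succ_eq a N
        rw [sum_range_reflect_sub (fun i j => ((N : R) + i + 2) * a (i + 1) *
          homogenizedCoeff a N j), ← neg_eq_iff_eq_neg] at h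
        convert neg_mem (J.mul_mem_left ((N : R) + 1) hJ1) using 1
        rw [h]
        refine Finset.sum_congr rfl fun l hl => ?_
        have := Finset.mem_range.mp hl
        simp only [c]
        rw [if_neg (by omega), if_pos heq, if_pos (by omega), mul_one]
      · rw [sum_range_reflect_sub (fun i j => ((i : R) + 1) * a (i + 2) *
          homogenizedCoeff a N j)] at hJ2
        convert hJ2 using 1
        refine Finset.sum_congr rfl fun l hl => ?_
        have := Finset.mem_range.mp hl
        simp only [c]
        rw [if_neg (by omega), if_neg (by omega), if_pos (by omega), mul_one]
    · simp only [c]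
      split_ifs with hN hl2 hN1 hlN hlN
      · refine Ideal.mul_mem_left _ _ ?_
        rcases (show m + 2 - l = 0 ∨ m + 2 - l = 1 by omega) with h | h <;> rw [h] <;> assumption
      · exact zero_mem _
      · rw [mul_one]
        refine Ideal.mul_mem_left _ _ ?_
        rwa [show N - l + 1 = 1 by omega]
      · simp
      · omega
      · simp
    · simp only [c]
      split_ifs with hN hl2 hN1 hlN hlN
      · rw [show m + 2 - m = 2 by omega]
        convert hnat (m + 3) using 2
        push_cast
        ring
      · omega
      · rw [show N - m = 1 by omega, mul_one]
        convert hnat (N + 2) using 2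
        push_cast
        ring
      · omega
      · rw [show N - m = 0 by omega, mul_one]
        exact hnat 0
      · omega
  obtain ⟨s, hs, hsg⟩ := key
  refine ⟨s, hs, fun q hq => ?_⟩
  induction hq using Submodule.span_induction with
  | mem q hq =>
    obtain ⟨m, hm, rfl⟩ := hq
    exact hsg m (Nat.lt_succ_of_le hm)
  | zero => simp
  | add x y _ _ hx hy => rw [mul_add]; exact add_mem hx hy
  | smul r x _ hx => rw [smul_eq_mul, mul_left_comm]; exact Ideal.mul_mem_left _ _ hx

end Generators

/-! ### Compatibility with ring homomorphisms -/

section Transport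

variable {R S : Type*} [CommRing R] [CommRing S] (a : ℕ → R) (φ : R →+* S)

lemma map_recipSqCoeff (hu : ∀ m : ℕ, IsUnit ((m : S) + 1)) (m : ℕ) :
    φ (recipSqCoeff a m) = recipSqCoeff (fun i => φ (a i)) m := by
  induction m using Nat.strong_induction_on with
  | _ m ih =>
    cases m with
    | zero => simp [recipSqCoeff_zero]
    | succ m =>
      rw [← (hu m).mul_right_inj, recipSqCoeff_succ]
      have h := congrArg φ (recipSqCoeff_succ a m)
      simp only [map_mul, map_add, map_natCast, map_one, map_neg, map_sum, map_pow,
        map_ofNat] at h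
      rw [h]
      congr 1
      refine Finset.sum_congr rfl fun i _ => ?_
      rw [ih _ (by omega)]

lemma map_homogenizedIdeal (hu : ∀ m : ℕ, IsUnit ((m : S) + 1)) (N : ℕ) :
    (homogenizedIdeal a N).map φ = homogenizedIdeal (fun i => φ (a i)) N := by
  rw [homogenizedIdeal, Ideal.map_span, homogenizedIdeal, Set.image_image]
  congr 1
  refine Set.image_congr fun m _ => ?_
  rw [homogenizedCoeff, homogenizedCoeff, map_mul, map_pow, map_recipSqCoeff a φ hu]

end Transport

/-! ### Primariness of the divided ideal -/

section Primary

open Polynomial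

variable {A : Type*} [CommRing A] (a : ℕ → A[X])

lemma isUnit_polynomial_natCast_add_one (hu : ∀ m : ℕ, IsUnit ((m : A) + 1)) (m : ℕ) :
    IsUnit ((m : A[X]) + 1) := by
  have h := (hu m).map (C : A →+* A[X])
  rwa [map_add, map_natCast, map_one] at h

variable (ha1 : a 1 = X) (ha : ∀ i, i ≠ 1 → ∃ c, a i = C c) (hu : ∀ m : ℕ, IsUnit ((m : A) + 1))
include ha1 ha hu

/-- In the recursion for `C_{m+1}` only the term with `a_1 C_m` raises the degree in `X`; the rest
`r` has degree at most `m`. -/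
lemma natDegree_recipSqCoeff_le_and_isUnit_coeff (m : ℕ) :
    (recipSqCoeff a m).natDegree ≤ m ∧ IsUnit ((recipSqCoeff a m).coeff m) := by
  induction m using Nat.strong_induction_on with
  | _ m ih =>
    cases m with
    | zero => simp [recipSqCoeff_zero]
    | succ m =>
      obtain ⟨p, hp⟩ := ha 0 zero_ne_one
      choose b hb using fun i : ℕ => ha (i + 2) (by omega)
      obtain ⟨v, hv⟩ := (hu m).exists_left_inv
      set r : A[X] := ∑ i ∈ Finset.range m, C (((m : A) + i + 3) * (b i * p ^ (i + 1))) *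
        recipSqCoeff a (m - (i + 1)) with hr
      have h1 : recipSqCoeff a (m + 1) =
          C (-v) * (C ((m : A) + 2) * (X * recipSqCoeff a m) + r) := by
        have h := recipSqCoeff_succ a m
        rw [Finset.sum_range_succ', zero_add, ha1, hp] at h
        have h2 : C v * ((m : A[X]) + 1) = 1 := by
          rw [← map_natCast C, ← C_1, ← C_add, ← C_mul, hv]
        have h3 : r = ∑ i ∈ Finset.range m, ((m : A[X]) + (i + 1 : ℕ) + 2) *
            (a (i + 1 + 1) * C p ^ (i + 1)) * recipSqCoeff a (m - (i + 1)) := by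
          refine Finset.sum_congr rfl fun i _ => ?_
          rw [hb]
          simp only [map_mul, map_add, map_natCast, map_pow, map_ofNat]
          push_cast
          ring
        rw [← h3] at h
        simp only [map_neg, map_add, map_natCast, map_ofNat]
        rw [Nat.sub_zero, pow_zero, Nat.cast_zero] at h
        linear_combination (C v) * h - recipSqCoeff a (m + 1) * h2
      have hrdeg : r.natDegree ≤ m := by
        refine natDegree_sum_le_of_forall_le _ _ fun i hi => ?_
        exact (natDegree_C_mul_le _ _).trans ((ih _ (by omega)).1.trans (Nat.sub_le _ _))
      obtain ⟨hd, hc⟩ := ih m (Nat.lt_succ_self m)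
      rw [h1]
      constructor
      · refine (natDegree_C_mul_le _ _).trans (natDegree_add_le_of_degree_le ?_ (by omega))
        refine (natDegree_C_mul_le _ _).trans (natDegree_mul_le.trans ?_)
        have := natDegree_X_le (R := A)
        omega
      · rw [coeff_C_mul, coeff_add, coeff_C_mul, coeff_X_mul,
          coeff_eq_zero_of_natDegree_lt (Nat.lt_succ_of_le hrdeg), add_zero]
        refine (IsUnit.of_mul_eq_one _ hv).neg.mul (IsUnit.mul ?_ hc)
        convert hu (m + 1) using 1
        push_cast
        ring

/-- The relation of order `m + 1` contains `a_1 = X` only in the term `(m + 2) a_1 g_m`; solving for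
it needs `m + 2` invertible. -/
lemma X_mul_homogenizedCoeff_mem_span {N m : ℕ} (hm : m < N) :
    X * homogenizedCoeff a N m ∈
      Submodule.span A (homogenizedCoeff a N '' Set.Iic N) := by
  obtain ⟨p, hp⟩ := ha 0 zero_ne_one
  choose b hb using fun i : ℕ => ha (i + 2) (by omega)
  obtain ⟨v, hv⟩ := (hu (m + 1)).exists_left_inv
  have h2 : C v * ((m : A[X]) + 2) = 1 := by
    rw [← C_1, ← hv, C_mul]
    congr 1
    simp only [map_add, map_natCast, map_one]
    push_cast
    ring
  have h := sum_range_mul_homogenizedCoeff a (show m + 1 ≤ N by omega)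
  rw [Finset.sum_range_succ', Finset.sum_range_succ', hp, zero_add, ha1] at h
  have h3 : X * homogenizedCoeff a N m = (-v) • (∑ i ∈ Finset.range m,
      (((m : A) + i + 3) * b i) • homogenizedCoeff a N (m + 1 - (i + 1 + 1)) +
        (((m : A) + 1) * p) • homogenizedCoeff a N (m + 1)) := by
    have h4 : ∑ i ∈ Finset.range m, (((m : A) + i + 3) * b i) •
        homogenizedCoeff a N (m + 1 - (i + 1 + 1)) = ∑ i ∈ Finset.range m,
          (((m + 1 : ℕ) : A[X]) + (i + 1 + 1 : ℕ)) * a (i + 1 + 1) *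
            homogenizedCoeff a N (m + 1 - (i + 1 + 1)) := by
      refine Finset.sum_congr rfl fun i _ => ?_
      rw [hb, smul_eq_C_mul]
      simp only [map_mul, map_add, map_natCast, map_ofNat]
      push_cast
      ring
    rw [h4, smul_eq_C_mul, smul_eq_C_mul]
    simp only [map_mul, map_add, map_natCast, map_one, map_neg]
    rw [Nat.add_sub_cancel, Nat.sub_zero] at h
    push_cast at h ⊢
    linear_combination (C v) * h - X * homogenizedCoeff a N m * h2
  rw [h3]
  have hmem : ∀ j ≤ N, homogenizedCoeff a N j ∈
      Submodule.span A (homogenizedCoeff a N '' Set.Iic N) :=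
    fun j hj => Submodule.subset_span ⟨j, hj, rfl⟩
  refine Submodule.smul_mem _ _ (add_mem (Submodule.sum_mem _ fun i _ => ?_) ?_)
  · exact Submodule.smul_mem _ _ (hmem _ (by omega))
  · exact Submodule.smul_mem _ _ (hmem _ (by omega))

omit ha1 ha hu in
lemma span_C_X_eq_comap (p : A) :
    Ideal.span {C p, X} = (Ideal.span {p}).comap (constantCoeff : A[X] →+* A) := by
  refine le_antisymm (Ideal.span_le.mpr ?_) fun z hz => ?_
  · rintro z (rfl | rfl)
    · simp
    · simp
  · rw [← X_mul_divX_add z]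
    have hz' := Ideal.mem_span_singleton.mp hz
    obtain ⟨w, hw⟩ := hz'
    rw [constantCoeff_apply] at hw
    rw [hw, C_mul]
    exact add_mem (Ideal.mul_mem_right _ _ (Ideal.subset_span (Or.inr rfl)))
      (Ideal.mul_mem_right _ _ (Ideal.subset_span (Or.inl rfl)))

theorem isPrimary_homogenizedIdeal [IsDomain A] {p : A} (hp : Prime p) (hap : a 0 = C p) {N : ℕ}
    (hN : N ≠ 0) : (homogenizedIdeal a N).IsPrimary ∧
      (homogenizedIdeal a N).radical = Ideal.span {a 0, a 1} := by
  have hu' := isUnit_polynomial_natCast_add_one hu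
  have hP := span_C_X_eq_comap p
  have hpp : (Ideal.span {p}).IsPrime := (Ideal.span_singleton_prime hp.ne_zero).mpr hp
  have hPp : (Ideal.span {C p, (X : A[X])}).IsPrime := hP ▸ Ideal.comap_isPrime _ _
  have hle : homogenizedIdeal a N ≤ Ideal.span {C p, X} := by
    refine homogenizedIdeal_le a hu' ?_ ?_ hN
    · exact hap ▸ Ideal.subset_span (Or.inl rfl)
    · exact ha1 ▸ Ideal.subset_span (Or.inr rfl)
  have hrad : (homogenizedIdeal a N).radical = Ideal.span {C p, X} := by
    refine le_antisymm ((Ideal.IsPrime.radical_le_iff hPp).mpr hle) (Ideal.span_le.mpr ?_)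
    rintro z (rfl | rfl)
    · exact hap ▸ zero_mem_radical_homogenizedIdeal a N
    · exact ha1 ▸ one_mem_radical_homogenizedIdeal a hu' N
  rw [hap, ha1]
  refine ⟨Ideal.isPrimary_iff.mpr ⟨fun h => hPp.ne_top (top_le_iff.mp (h ▸ hle)), ?_⟩, hrad⟩
  intro x y hxy
  by_cases hy : p ∣ y.coeff 0
  · right
    rw [hrad, hP]
    exact Ideal.mem_span_singleton.mpr hy
  · left
    obtain ⟨e, he⟩ : X ∈ (homogenizedIdeal a N).radical :=
      ha1 ▸ one_mem_radical_homogenizedIdeal a hu' N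
    have hse : ¬ p ∣ y.coeff 0 ^ e := fun h => hy (hp.dvd_of_dvd_pow h)
    refine mem_span_of_C_mul_mem_span hp hse N (homogenizedCoeff a N) ?_ ?_ ?_ ?_
    · intro m hm
      rw [homogenizedCoeff, hap, ← C_pow]
      exact (natDegree_C_mul_le _ _).trans
        (natDegree_recipSqCoeff_le_and_isUnit_coeff a ha1 ha hu m).1
    · intro m hm
      refine ⟨_, N - m, (natDegree_recipSqCoeff_le_and_isUnit_coeff a ha1 ha hu m).2, ?_⟩
      rw [homogenizedCoeff, hap, ← C_pow, coeff_C_mul, mul_comm]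
    · exact fun m hm => X_mul_homogenizedCoeff_mem_span a ha1 ha hu hm
    -- Modulo `y` the constant coefficient of `y` equals `-X * divX y`, so its `e`-th power lies in
    -- `(y, X ^ e)` and multiplies `x` into the ideal; saturation then removes it.
    · obtain ⟨w, hw⟩ := sub_dvd_pow_sub_pow (C (y.coeff 0)) (-(X * divX y)) e
      have h1 : C (y.coeff 0) - -(X * divX y) = y := by
        rw [sub_neg_eq_add, add_comm, X_mul_divX_add]
      rw [h1, sub_eq_iff_eq_add] at hw
      rw [C_pow, hw, add_mul]
      refine add_mem ?_ ?_
      · rw [show y * w * x = w * (x * y) by ring]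
        exact Ideal.mul_mem_left _ _ hxy
      · rw [neg_pow, mul_pow]
        rw [show (-1) ^ e * (X ^ e * divX y ^ e) * x = (-1) ^ e * divX y ^ e * x * X ^ e by ring]
        exact Ideal.mul_mem_left _ _ he

omit ha1 ha in
lemma isPrimary_homogenizedIdeal_of_ringEquiv [IsDomain A] {R : Type*} [CommRing R] (a : ℕ → R)
    (φ : R ≃+* A[X]) (ha1 : φ (a 1) = X) (ha : ∀ i, i ≠ 1 → ∃ c, φ (a i) = C c) {p : A}
    (hp : Prime p) (hap : φ (a 0) = C p) {N : ℕ} (hN : N ≠ 0) :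
    (homogenizedIdeal a N).IsPrimary ∧
      (homogenizedIdeal a N).radical = Ideal.span {a 0, a 1} := by
  obtain ⟨h1, h2⟩ := isPrimary_homogenizedIdeal (fun i => φ (a i)) ha1 ha hu hp hap hN
  have hcomap : ∀ I : Ideal R, (I.map (φ : R →+* A[X])).comap (φ : R →+* A[X]) = I :=
    fun I => Ideal.comap_map_of_bijective _ φ.bijective
  have hI := hcomap (homogenizedIdeal a N)
  rw [map_homogenizedIdeal _ _ (isUnit_polynomial_natCast_add_one hu)] at hI
  have hP := hcomap (Ideal.span {a 0, a 1})
  rw [Ideal.map_span, Set.image_pair] at hP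
  rw [← hI, ← hP, ← Ideal.comap_radical]
  exact ⟨h1.comap _, congrArg _ h2⟩

end Primary

/-! ### Dividing by the greatest common divisor -/

section GCD

variable {R : Type*} [CommRing R] [IsDomain R]

/-- The member with `m = 0` forces a common divisor to be a power of `p` up to a unit, and the one
with `m = N` bounds the exponent by `1`. -/
lemma isSetGCD_of_prime {p w : R} (hp : Prime p) (hw : IsUnit w) {N : ℕ} {g : ℕ → R}
    (h0 : g 0 = p ^ N) (hN : ¬ p ∣ g N) :
    IsSetGCD {q | ∃ m ≤ N, q = w * (p * g m)} p := by
  refine fun e => ⟨?_, fun h => ?_⟩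
  · rintro he _ ⟨m, _, rfl⟩
    exact dvd_mul_of_dvd_right (dvd_mul_of_dvd_left he _) _
  · have h1 := h _ ⟨0, N.zero_le, rfl⟩
    rw [hw.dvd_mul_left, h0, ← pow_succ', dvd_prime_pow hp] at h1
    obtain ⟨i, _, hi⟩ := h1
    have h2 := h _ ⟨N, le_rfl, rfl⟩
    rw [hw.dvd_mul_left, hi.dvd_iff_dvd_left] at h2
    rw [hi.dvd_iff_dvd_left]
    have h3 : i ≤ 1 := by
      by_contra hcon
      refine hN ((mul_dvd_mul_iff_left hp.ne_zero).mp (dvd_trans ?_ h2))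
      rw [← pow_two]
      exact pow_dvd_pow p (by omega)
    simpa using pow_dvd_pow p h3

lemma gcdQuotientIdeal_eq_span {p w : R} (hp : Prime p) (hw : IsUnit w) {N : ℕ} {g : ℕ → R}
    (h0 : g 0 = p ^ N) (hN : ¬ p ∣ g N) :
    gcdQuotientIdeal {q | ∃ m ≤ N, q = w * (p * g m)} = Ideal.span (g '' Set.Iic N) := by
  have hgcd := isSetGCD_of_prime hp hw h0 hN
  refine le_antisymm (Ideal.span_le.mpr ?_) (Ideal.span_le.mpr ?_)
  · rintro q ⟨d, hd, hds, m, hm, hq⟩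
    have hpd : p ∣ d := (hds p).mpr ((hgcd p).mp dvd_rfl)
    have hdp : d ∣ p := (hgcd d).mpr ((hds d).mp dvd_rfl)
    obtain ⟨u, rfl⟩ := associated_of_dvd_dvd hpd hdp
    have h1 : (u : R) * q = w * g m := mul_left_cancel₀ hp.ne_zero (by linear_combination hq)
    rw [SetLike.mem_coe, ← Ideal.unit_mul_mem_iff_mem _ u.isUnit, h1]
    exact Ideal.mul_mem_left _ _ (Ideal.subset_span ⟨m, hm, rfl⟩)
  · rintro _ ⟨m, hm, rfl⟩
    rw [SetLike.mem_coe, ← Ideal.unit_mul_mem_iff_mem _ hw]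
    exact Ideal.subset_span ⟨p, hp.ne_zero, hgcd, m, hm, by ring⟩

end GCD

end SubHankel

namespace SubHankel

/-! ### The gradient ideal of the sub-Hankel determinant -/

section SubHankelIdeals

open MvPolynomial

variable (k : Type*) [Field k]

lemma prime_revVar_zero (n : ℕ) : Prime (revVar k n 0) := by
  rw [revVar_of_le k n n.zero_le]
  exact X_prime

lemma exists_pderiv_eq (N : ℕ) : ∃ w : MvPolynomial (Fin (N + 2 + 1)) k, IsUnit w ∧
    (∀ m (hm : m ≤ N + 1), pderiv (⟨m, by omega⟩ : Fin (N + 2 + 1)) (subHankelDet k (N + 2)) =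
      w * (revVar k (N + 2) 0 ^ (N + 1 - m) * recipSqCoeff (revVar k (N + 2)) m)) ∧
    pderiv (Fin.last (N + 2)) (subHankelDet k (N + 2)) =
      w * ∑ i ∈ Finset.range (N + 1), ((i : MvPolynomial (Fin (N + 2 + 1)) k) + 1) *
        revVar k (N + 2) (i + 2) * homogenizedCoeff (revVar k (N + 2)) N (N - i) := by
  obtain ⟨e, he, hf⟩ := exists_subHankelDet_eq k (N + 2)
  refine ⟨C (-e), (IsUnit.mk0 _ (neg_ne_zero.mpr he)).map C, fun m hm => ?_, ?_⟩
  · have h := derivation_recipCoeff_of_pos (revVar k (N + 2))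
      (pderiv (⟨N + 2 - (N + 2 - m), by omega⟩ : Fin (N + 2 + 1))) (j := N + 2 - m) (m := N + 2)
      (by omega) (by omega) (pderiv_revVar k (N + 2) (by omega))
    have hm' : N + 2 - (N + 2 - m) = m := by omega
    simp only [hm'] at h
    rw [hf, pderiv_C_mul, h, show N + 2 - m - 1 = N + 1 - m by omega, C_neg]
    ring
  · have h := derivation_recipCoeff_zero (revVar k (N + 2)) (pderiv (Fin.last (N + 2))) N
      (pderiv_revVar k (N + 2) (Nat.zero_le _))
    rw [hf, pderiv_C_mul, h, C_neg, mul_neg, neg_mul]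
    refine congrArg (fun x => -(C e * x)) (Finset.sum_congr rfl fun i hi => ?_)
    rw [← pow_mul_recipSqCoeff _ le_rfl (by have := Finset.mem_range.mp hi; omega), Nat.sub_self]
    ring

variable [CharZero k]

lemma isUnit_mvPolynomial_natCast_add_one (σ : Type*) (m : ℕ) :
    IsUnit ((m : MvPolynomial σ k) + 1) := by
  have h : (m : k) + 1 ≠ 0 := Nat.cast_add_one_ne_zero m
  have h2 := (IsUnit.mk0 _ h).map (C : k →+* MvPolynomial σ k)
  rwa [map_add, map_natCast, map_one] at h2

lemma not_revVar_zero_dvd_recipSqCoeff {n : ℕ} (hn : n ≠ 0) (m : ℕ) :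
    ¬ revVar k n 0 ∣ recipSqCoeff (revVar k n) m := by
  intro h
  have hu := isUnit_mvPolynomial_natCast_add_one k (Fin (n + 1))
  have h1 := (dvd_sub_right h).mp (dvd_recipSqCoeff_sub (revVar k n) hu m)
  rw [(isUnit_neg_one_pow_mul hu m).dvd_mul_left] at h1
  have h2 := (prime_revVar_zero k n).dvd_of_dvd_pow h1
  rw [revVar_of_le k n n.zero_le, revVar_of_le k n (Nat.one_le_iff_ne_zero.mpr hn), X_dvd_X] at h2
  have h3 := Fin.mk.inj_iff.mp h2
  omega

lemma dividedIdeal_eq (N : ℕ) :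
    dividedIdeal k (N + 2) N = homogenizedIdeal (revVar k (N + 2)) N := by
  obtain ⟨w, hw, hpd, -⟩ := exists_pderiv_eq k N
  have hpd' : ∀ m (hm : m ≤ N), pderiv (⟨m, by omega⟩ : Fin (N + 2 + 1))
      (subHankelDet k (N + 2)) =
        w * (revVar k (N + 2) 0 * homogenizedCoeff (revVar k (N + 2)) N m) := fun m hm => by
    rw [hpd m (by omega), homogenizedCoeff, show N + 1 - m = N - m + 1 by omega, pow_succ']
    ring
  rw [homogenizedIdeal, ← gcdQuotientIdeal_eq_span (prime_revVar_zero k (N + 2)) hw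
    (homogenizedCoeff_zero _ N) (by
      rw [homogenizedCoeff_self]
      exact not_revVar_zero_dvd_recipSqCoeff k (by omega) N), dividedIdeal]
  congr 1
  ext q
  constructor
  · rintro ⟨j, hj, rfl⟩
    exact ⟨j, hj, hpd' j hj⟩
  · rintro ⟨m, hm, rfl⟩
    exact ⟨⟨m, by omega⟩, hm, (hpd' m hm).symm⟩

lemma gradientIdeal_le (N : ℕ) :
    gradientIdeal k (N + 2) ≤ homogenizedIdeal (revVar k (N + 2)) N := by
  have hu := isUnit_mvPolynomial_natCast_add_one k (Fin (N + 2 + 1))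
  obtain ⟨w, hw, hpd, hlast⟩ := exists_pderiv_eq k N
  refine Ideal.span_le.mpr ?_
  rintro _ ⟨j, rfl⟩
  simp only [SetLike.mem_coe]
  rcases lt_trichotomy j.val (N + 1) with hlt | heq | hgt
  · rw [show j = ⟨j.val, by omega⟩ from rfl, hpd j (by omega),
      show N + 1 - j.val = N - j.val + 1 by omega, pow_succ', mul_assoc]
    exact Ideal.mul_mem_left _ _ (Ideal.mul_mem_left _ _ (homogenizedCoeff_mem _ (by omega)))
  · rw [show j = ⟨N + 1, by omega⟩ from Fin.ext heq, hpd _ le_rfl]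
    exact Ideal.mul_mem_left _ _ (Ideal.mul_mem_left _ _ (recipSqCoeff_succ_mem _ hu N))
  · rw [show j = Fin.last (N + 2) from Fin.ext (by rw [Fin.val_last]; omega), hlast]
    exact Ideal.mul_mem_left _ _ (Ideal.sum_mem _ fun i _ =>
      Ideal.mul_mem_left _ _ (homogenizedCoeff_mem _ (Nat.sub_le _ _)))

omit [CharZero k] in
lemma recipSqCoeff_mem_gradientIdeal (N : ℕ) :
    recipSqCoeff (revVar k (N + 2)) (N + 1) ∈ gradientIdeal k (N + 2) := by
  obtain ⟨w, hw, hpd, -⟩ := exists_pderiv_eq k N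
  have h := hpd (N + 1) le_rfl
  rw [Nat.sub_self, pow_zero, one_mul] at h
  rw [← Ideal.unit_mul_mem_iff_mem _ hw, ← h]
  exact Ideal.subset_span ⟨_, rfl⟩

omit [CharZero k] in
lemma sum_mem_gradientIdeal (N : ℕ) :
    ∑ i ∈ Finset.range (N + 1), ((i : MvPolynomial (Fin (N + 2 + 1)) k) + 1) *
      revVar k (N + 2) (i + 2) * homogenizedCoeff (revVar k (N + 2)) N (N - i) ∈
        gradientIdeal k (N + 2) := by
  obtain ⟨w, hw, -, hlast⟩ := exists_pderiv_eq k N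
  rw [← Ideal.unit_mul_mem_iff_mem _ hw, ← hlast]
  exact Ideal.subset_span ⟨_, rfl⟩

omit [CharZero k] in
lemma revVar_zero_mem_radical_gradientIdeal (N : ℕ) :
    revVar k (N + 2) 0 ∈ (gradientIdeal k (N + 2)).radical := by
  obtain ⟨w, hw, hpd, -⟩ := exists_pderiv_eq k N
  have h := hpd 0 (Nat.zero_le _)
  rw [recipSqCoeff_zero, mul_one] at h
  refine ⟨N + 1 - 0, ?_⟩
  rw [← Ideal.unit_mul_mem_iff_mem _ hw, ← h]
  exact Ideal.subset_span ⟨_, rfl⟩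

omit [CharZero k] in
lemma exists_algEquiv_polynomial (n : ℕ) (v : Fin (n + 1)) :
    ∃ φ : MvPolynomial (Fin (n + 1)) k ≃ₐ[k] Polynomial (MvPolynomial (Fin n) k),
      φ (X v) = Polynomial.X ∧ ∀ i ≠ v, ∃ j, φ (X i) = Polynomial.C (X j) := by
  refine ⟨(renameEquiv k (Equiv.swap v 0)).trans (finSuccEquiv k n), ?_, fun i hi => ?_⟩
  · rw [AlgEquiv.trans_apply, renameEquiv_apply, rename_X, Equiv.swap_apply_left,
      finSuccEquiv_X_zero]
  · have h0 : Equiv.swap v 0 i ≠ 0 := fun h =>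
      hi ((Equiv.swap v 0).injective (h.trans (Equiv.swap_apply_left v 0).symm))
    obtain ⟨j, hj⟩ := Fin.exists_succ_eq.mpr h0
    refine ⟨j, ?_⟩
    rw [AlgEquiv.trans_apply, renameEquiv_apply, rename_X, ← hj, finSuccEquiv_X_succ]

lemma isPrimary_homogenizedIdeal_revVar {N : ℕ} (hN : N ≠ 0) :
    (homogenizedIdeal (revVar k (N + 2)) N).IsPrimary ∧
      (homogenizedIdeal (revVar k (N + 2)) N).radical =
        Ideal.span {revVar k (N + 2) 0, revVar k (N + 2) 1} := by
  obtain ⟨φ, hφ, hφ'⟩ := exists_algEquiv_polynomial k (N + 2) ⟨N + 2 - 1, by omega⟩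
  rw [← revVar_of_le k (N + 2) (by omega)] at hφ
  have hne : ∀ i ≤ N + 2, i ≠ 1 → ∃ j, φ (revVar k (N + 2) i) = Polynomial.C (X j) := by
    intro i hin hi
    rw [revVar_of_le k (N + 2) hin]
    exact hφ' _ (fun h => by
      have := Fin.mk.inj_iff.mp h
      omega)
  obtain ⟨j, hj⟩ := hne 0 (Nat.zero_le _) zero_ne_one
  refine isPrimary_homogenizedIdeal_of_ringEquiv
    (isUnit_mvPolynomial_natCast_add_one k (Fin (N + 2))) (revVar k (N + 2)) φ.toRingEquiv hφ
    (fun i hi => ?_) X_prime hj hN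
  by_cases hin : i ≤ N + 2
  · obtain ⟨j, hj⟩ := hne i hin hi
    exact ⟨_, hj⟩
  · exact ⟨0, by rw [revVar, if_neg hin, map_zero, map_zero]⟩

/-- Up to units, `∂f/∂x_0` is a power of `a_0`, and `∂f/∂x_{n-1}` is `C_{N+1}`, a power of `a_1`
modulo `a_0`. -/
lemma radical_gradientIdeal {N : ℕ} (hN : N ≠ 0) : (gradientIdeal k (N + 2)).radical =
    Ideal.span {revVar k (N + 2) 0, revVar k (N + 2) 1} := by
  refine le_antisymm ?_ (Ideal.span_le.mpr ?_)
  · rw [← (isPrimary_homogenizedIdeal_revVar k hN).2]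
    exact Ideal.radical_mono (gradientIdeal_le k N)
  · have h0 := revVar_zero_mem_radical_gradientIdeal k N
    rintro z (rfl | rfl)
    · exact h0
    · exact mem_radical_of_recipSqCoeff_mem _ (isUnit_mvPolynomial_natCast_add_one k _) h0
        (recipSqCoeff_mem_gradientIdeal k N)

omit [CharZero k] in
lemma revVar_two_notMem (N : ℕ) :
    revVar k (N + 2) 2 ∉ Ideal.span {revVar k (N + 2) 0, revVar k (N + 2) 1} := by
  rw [revVar_of_le k (N + 2) (by omega), revVar_of_le k (N + 2) (by omega),
    revVar_of_le k (N + 2) (by omega), ← Set.image_pair, mem_ideal_span_X_image]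
  intro h
  obtain ⟨i, hi, hne⟩ := h (Finsupp.single ⟨N + 2 - 2, by omega⟩ 1) (by simp [support_X])
  rw [Finsupp.single_apply_ne_zero] at hne
  rcases hi with hi | hi <;>
  · have h1 := congrArg Fin.val (hi.symm.trans hne.1)
    simp only at h1
    omega

end SubHankelIdeals

end SubHankel

/-- For `n ≥ 3` and `k` a field of characteristic zero, the radical of the gradient ideal `J` of
the sub-Hankel determinant is `P = (x_{n-1}, x_n)`, and `J` has exactly one `P`-primary component,
namely `J_{n-2}`. -/
theorem mainTheorem6 (k : Type*) [Field k] [CharZero k] (n : ℕ) (hn : 3 ≤ n)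
    (P : Ideal (MvPolynomial (Fin (n + 1)) k))
    (hP : P = Ideal.span
      {MvPolynomial.X (⟨n - 1, by omega⟩ : Fin (n + 1)),
        MvPolynomial.X (⟨n, by omega⟩ : Fin (n + 1))}) :
    (SubHankel.gradientIdeal k n).radical = P ∧
      ∀ Q : Ideal (MvPolynomial (Fin (n + 1)) k),
        SubHankel.IsPrimaryComponent (SubHankel.gradientIdeal k n) P Q ↔
          Q = SubHankel.dividedIdeal k n (n - 2) := by
  obtain ⟨N, rfl⟩ : ∃ N, n = N + 2 := ⟨n - 2, by omega⟩
  -- Here `3 ≤ n` enters: for `N = 0` the divided ideal contains `g_0 = 1`.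
  have hN : N ≠ 0 := by omega
  have hP' : P = Ideal.span {SubHankel.revVar k (N + 2) 0, SubHankel.revVar k (N + 2) 1} := by
    rw [hP, SubHankel.revVar_of_le k (N + 2) (Nat.zero_le _),
      SubHankel.revVar_of_le k (N + 2) (by omega), Set.pair_comm]
    rfl
  subst hP'
  obtain ⟨hprim, hrad⟩ := SubHankel.isPrimary_homogenizedIdeal_revVar k hN
  have hprime : (Ideal.span {SubHankel.revVar k (N + 2) 0, SubHankel.revVar k (N + 2) 1}).IsPrime :=
    hrad ▸ Ideal.isPrime_radical hprim
  obtain ⟨s, hs, hsQ⟩ := SubHankel.exists_notMem_forall_mul_homogenizedIdeal_mem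
    (SubHankel.revVar k (N + 2)) (SubHankel.isUnit_mvPolynomial_natCast_add_one k _)
    (Ideal.subset_span (Or.inl rfl)) (Ideal.subset_span (Or.inr rfl))
    (SubHankel.revVar_two_notMem k N) (SubHankel.recipSqCoeff_mem_gradientIdeal k N)
    (SubHankel.sum_mem_gradientIdeal k N)
  have hJ := SubHankel.radical_gradientIdeal k hN
  refine ⟨hJ, fun Q => ?_⟩
  rw [Nat.add_sub_cancel, SubHankel.dividedIdeal_eq]
  exact SubHankel.isPrimaryComponent_iff_eq hJ hprim hrad (SubHankel.gradientIdeal_le k N) hs hsQ Q
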